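/- A \emph{family of languages} $\mathcal L$ assigns to every finite alphabet $\Sigma$ a set of languages over $\Sigma$. It is a \emph{full trio} if it is closed under (arbitrary, possibly erasing) homomorphism, inverse homomorphism, and intersection with regular languages; a \emph{full AFL} is a full trio that is also closed under union, concatenation and Kleene star. A language $L$ over $\Sigma=\{a_1,\dots,a_k\}$ is \emph{semilinear} if its Parikh image $\{(|w|_{a_1},\dots,|w|_{a_k}) : w\in L\}\subseteq\mathbb N_0^k$ is a finite union of linear sets $\{v_0+i_1v_1+\cdots+i_mv_m : i_1,\dots,i_m\in\mathbb N_0\}$; a family is semilinear if all its languages are. Let $\mathsf{NCM}$ be the family of languages accepted by one-way nondeterministic $\ell$-reversal-bounded $k$-counter machines, for some $k,\ell\ge 0$. Such a machine is a nondeterministic finite automaton with $\lambda$-transitions and $k$ counters that hold non-negative integers and are initially zero; each transition may depend on which counters are zero and may increment, decrement or leave unchanged each counter (a counter that is zero cannot be decremented). A word is accepted if some computation reads all of it and ends in a final state. The machine is $\ell$-reversal-bounded if in every accepting computation each counter makes at most $\ell$ changes between non-decreasing and non-increasing. For a family $\mathcal L$, let $\hat{\mathcal F}_{\mathsf{NCM}}(\mathcal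 L)$ be the smallest full AFL that contains $\mathcal L$ and is closed under intersection with languages from $\mathsf{NCM}$. \textbf{Proposition.} If $\mathcal L$ is a semilinear full trio, then $\hat{\mathcal F}_{\mathsf{NCM}}(\mathcal L)$ is semilinear. -/

import Mathlib

/-- A family of languages: for every finite alphabet `α`, a set of languages over `α`. -/
def LanguageFamily : Type 1 :=
  (α : Type) → [Finite α] → Set (Language α)

namespace LanguageFamily

/-- Image of `L` under the homomorphism `α* → β*` that extends `h : α → β*`
(letters may be erased). -/
def homImage {α β : Type} (h : α → List β) (L : Language α) : Language β :=
  {v | ∃ w ∈ L, w.flatMap h = v}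

/-- Inverse image of `L` under the homomorphism `α* → β*` that extends `h : α → β*`. -/
def homPreimage {α β : Type} (h : α → List β) (L : Language β) : Language α :=
  {w | w.flatMap h ∈ L}

/-- The Parikh vector of a word: the number of occurrences of each letter. -/
noncomputable def parikh {α : Type} (w : List α) : α → ℕ :=
  open scoped Classical in fun a => w.count a

/-- A language is semilinear if its Parikh image is a semilinear set. -/
def IsSemilinearLanguage {α : Type} (L : Language α) : Prop :=
  IsSemilinearSet {v : α → ℕ | ∃ w ∈ L, parikh w = v}

/-- A family is semilinear if all its languages are. -/
def IsSemilinear (F : LanguageFamily) : Prop :=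
  ∀ (α : Type) [Finite α], ∀ L ∈ F α, IsSemilinearLanguage L

/-- `F ⊆ G`. -/
def Contained (F G : LanguageFamily) : Prop :=
  ∀ (α : Type) [Finite α], F α ⊆ G α

/-- Full trio: closed under homomorphism, inverse homomorphism and intersection with regular
languages. -/
structure IsFullTrio (F : LanguageFamily) : Prop where
  hom : ∀ {α β : Type} [Finite α] [Finite β] (h : α → List β), ∀ L ∈ F α, homImage h L ∈ F β
  invHom : ∀ {α β : Type} [Finite α] [Finite β] (h : α → List β),
    ∀ L ∈ F β, homPreimage h L ∈ F α
  interRegular : ∀ {α : Type} [Finite α], ∀ L ∈ F α, ∀ R : Language α, R.IsRegular → L ⊓ R ∈ F α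

/-- Full AFL: a full trio closed under union, concatenation and Kleene star. -/
structure IsFullAFL (F : LanguageFamily) : Prop extends IsFullTrio F where
  union : ∀ {α : Type} [Finite α], ∀ L₁ ∈ F α, ∀ L₂ ∈ F α, L₁ ⊔ L₂ ∈ F α
  concat : ∀ {α : Type} [Finite α], ∀ L₁ ∈ F α, ∀ L₂ ∈ F α, L₁ * L₂ ∈ F α
  star : ∀ {α : Type} [Finite α], ∀ L ∈ F α, KStar.kstar L ∈ F α

/-- `F` is closed under intersection with languages from `G`. -/
def ClosedUnderInter (F G : LanguageFamily) : Prop :=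
  ∀ (α : Type) [Finite α], ∀ L ∈ F α, ∀ K ∈ G α, L ⊓ K ∈ F α

end LanguageFamily

/-- A one-way nondeterministic machine over the input alphabet `α` with finitely many states and
`k` counters. `trans q a z p d` says: in state `q`, on reading the letter `a` (or, for
`a = none`, without reading), when exactly the counters `i` with `z i = true` are zero, the machine
may go to state `p` and add `d i ∈ {-1, 0, 1}` to each counter `i`. -/
structure CounterMachine (α : Type) (k : ℕ) where
  State : Type
  finite_state : Finite State
  start : State
  accept : Set State
  trans : State → Option α → (Fin k → Bool) → State → (Fin k → SignType) → Prop

namespace CounterMachine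

variable {α : Type} {k : ℕ}

/-- A configuration: the current state, the unread input and the counter values. -/
structure Config (M : CounterMachine α k) where
  state : M.State
  rest : List α
  counters : Fin k → ℕ

/-- One move, labelled by its counter updates. Counter values are natural numbers, so a counter
that is zero cannot be decremented. -/
inductive Step (M : CounterMachine α k) : M.Config → (Fin k → SignType) → M.Config → Prop
  | mk {q p : M.State} {a : Option α} {w : List α} {c c' : Fin k → ℕ} {d : Fin k → SignType}
      (htrans : M.trans q a (fun i => decide (c i = 0)) p d)
      (hcounters : ∀ i, (c' i : ℤ) = (c i : ℤ) + (d i : ℤ)) :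
      Step M ⟨q, a.toList ++ w, c⟩ d ⟨p, w, c'⟩

/-- A computation, labelled by the list of its counter updates. -/
inductive Run (M : CounterMachine α k) :
    M.Config → List (Fin k → SignType) → M.Config → Prop
  | nil (x : M.Config) : Run M x [] x
  | cons {x y z : M.Config} {d : Fin k → SignType} {ds : List (Fin k → SignType)}
      (hstep : Step M x d y) (hrun : Run M y ds z) : Run M x (d :: ds) z

/-- There is an accepting computation on `w` with the counter updates `ds`: it starts in the start
state with all counters zero, reads all of `w`, and ends in an accepting state. -/
def AcceptsWith (M : CounterMachine α k) (w : List α) (ds : List (Fin k → SignType)) : Prop :=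
  ∃ (q : M.State) (c : Fin k → ℕ),
    q ∈ M.accept ∧ M.Run ⟨M.start, w, fun _ => 0⟩ ds ⟨q, [], c⟩

/-- The language accepted by a machine. -/
def language (M : CounterMachine α k) : Language α :=
  {w | ∃ ds, M.AcceptsWith w ds}

/-- The number of changes of direction in a sequence of updates of one counter, where `s` is the
current direction; updates by `0` do not change the direction. -/
def reversals : SignType → List SignType → ℕ
  | _, [] => 0
  | s, d :: ds => if d = 0 ∨ d = s then reversals s ds else reversals d ds + 1

/-- `M` is `l`-reversal-bounded: in every accepting computation every counter makes at most `l`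
changes between non-decreasing and non-increasing (counters start in non-decreasing mode). -/
def ReversalBounded (M : CounterMachine α k) (l : ℕ) : Prop :=
  ∀ w ds, M.AcceptsWith w ds → ∀ i, reversals 1 (ds.map fun d => d i) ≤ l

end CounterMachine

namespace LanguageFamily

/-- Languages accepted by one-way nondeterministic `l`-reversal-bounded `k`-counter machines, for
some `k` and `l`. -/
def NCM : LanguageFamily := fun α _ =>
  {L | ∃ (k l : ℕ) (M : CounterMachine α k), M.ReversalBounded l ∧ M.language = L}

/-- The smallest full AFL that contains `F` and is closed under intersection with languages from
`NCM`, as the intersection of all of these. -/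
def fullAFLNCM (F : LanguageFamily) : LanguageFamily := fun α _ =>
  {L | ∀ G : LanguageFamily, G.IsFullAFL → G.ClosedUnderInter NCM → F.Contained G → L ∈ G α}

/-- `fullAFLNCM F` is a full AFL that contains `F` and is closed under intersection with `NCM`,
and is contained in every other one. -/
theorem fullAFLNCM_isLeast (F : LanguageFamily) :
    (fullAFLNCM F).IsFullAFL ∧ (fullAFLNCM F).ClosedUnderInter NCM ∧ F.Contained (fullAFLNCM F) ∧
      ∀ G : LanguageFamily, G.IsFullAFL → G.ClosedUnderInter NCM → F.Contained G →
        (fullAFLNCM F).Contained G := by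
  refine ⟨⟨⟨?_, ?_, ?_⟩, ?_, ?_, ?_⟩, ?_, ?_, ?_⟩
  · intro α β _ _ h L hL G hG hN hF
    exact hG.hom h L (hL G hG hN hF)
  · intro α β _ _ h L hL G hG hN hF
    exact hG.invHom h L (hL G hG hN hF)
  · intro α _ L hL R hR G hG hN hF
    exact hG.interRegular L (hL G hG hN hF) R hR
  · intro α _ L₁ h₁ L₂ h₂ G hG hN hF
    exact hG.union L₁ (h₁ G hG hN hF) L₂ (h₂ G hG hN hF)
  · intro α _ L₁ h₁ L₂ h₂ G hG hN hF
    exact hG.concat L₁ (h₁ G hG hN hF) L₂ (h₂ G hG hN hF)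
  · intro α _ L hL G hG hN hF
    exact hG.star L (hL G hG hN hF)
  · intro α _ L hL K hK G hG hN hF
    exact hN α L (hL G hG hN hF) K hK
  · intro α _ L hL G hG hN hF
    exact hF α hL
  · intro G hG hN hF α _ L hL
    exact hL G hG hN hF

end LanguageFamily

/-! Semilinearity alone is not preserved by intersection with regular languages, so the argument
needs a stronger invariant. Let `hereditary` consist of the languages L for which h⁻¹(L) ∩ R is
semilinear for every homomorphism h and every regular R. It contains every semilinear full trio, and
its members are semilinear (take h the identity and R everything). It remains to show that it is a
full AFL closed under intersection with `NCM`; minimality of `fullAFLNCM F` then gives the claim.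

Homomorphisms: the regular language `sync` of interleavings turns the equation h(w) = g(u) into a
regular condition, and projections preserve semilinearity. Concatenation and star: a word is cut
into factors, and the states of a DFA for R at the cuts are recorded. For star, Parikh vectors
become sums of labels along paths in a finite graph with semilinear label sets, and Kleene's
recursion (`PathSum.insert_eq`) keeps these semilinear.

Counter machines: consider words of moves, each move tagged, for every counter, with a segment
number below a bound that depends only on the reversal bound. Within a segment the zero test has a
constant answer and the counter moves in one direction only. Hence feasibility is decided by the
values at segment boundaries (`CounterMachine.tracks_iff`), which are linear in the Parikh vector of
the word of moves. Accepting computations thus form a regular language restricted by a semilinear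
Parikh constraint, and `hereditary` is stable under both restrictions. -/

namespace LanguageFamily

/-! ### Linear images of Parikh vectors -/

section Weight

variable {α M : Type} [AddCommMonoid M]

/-- The additive map that sends the Parikh vector of a word to the sum of the values `φ a` of its
letters. -/
noncomputable def weight [Finite α] (φ : α → M) : (α → ℕ) →+ M :=
  letI := Fintype.ofFinite α
  { toFun := fun v => ∑ a, v a • φ a
    map_zero' := by simp
    map_add' := fun v w => by simp [add_smul, Finset.sum_add_distrib] }

theorem parikh_nil : parikh ([] : List α) = 0 := by
  funext a
  simp [parikh]

open scoped Classical in
theorem parikh_cons (a : α) (w : List α) : parikh (a :: w) = Pi.single a 1 + parikh w := by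
  funext b
  by_cases h : a = b
  · subst h
    simp [parikh, add_comm]
  · simp [parikh, h, Ne.symm h]

theorem weight_parikh [Finite α] (φ : α → M) (w : List α) :
    weight φ (parikh w) = (w.map φ).sum := by
  classical
  induction w with
  | nil => simp [parikh_nil]
  | cons a w ih =>
    rw [parikh_cons, map_add, ih, List.map_cons, List.sum_cons]
    congr 1
    simp [weight, Pi.single_apply, ite_smul]

open scoped Classical in
theorem sum_map_single (w : List α) :
    (w.map fun a => (Pi.single a 1 : α → ℕ)).sum = parikh w := by
  induction w with
  | nil => simp [parikh_nil]
  | cons a w ih => simp [parikh_cons, ih]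

theorem parikh_append (u v : List α) : parikh (u ++ v) = parikh u + parikh v := by
  simp [← sum_map_single]

theorem IsSemilinearLanguage.of_forall {L : Language α} {T : Set (α → ℕ)} (hT : IsSemilinearSet T)
    (h : ∀ v, (∃ w ∈ L, parikh w = v) ↔ v ∈ T) : IsSemilinearLanguage L := by
  rwa [IsSemilinearLanguage, show {v | ∃ w ∈ L, parikh w = v} = T from Set.ext h]

theorem IsSemilinearLanguage.congr {K L : Language α} (hK : IsSemilinearLanguage K)
    (h : ∀ w, w ∈ K ↔ w ∈ L) : IsSemilinearLanguage L :=
  (Set.ext h : K = L) ▸ hK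

/-- Sums of letter values over a semilinear language form a semilinear set. -/
theorem IsSemilinearLanguage.image_sum [Finite α] {L : Language α} (hL : IsSemilinearLanguage L)
    (φ : α → M) : IsSemilinearSet {m | ∃ w ∈ L, (w.map φ).sum = m} := by
  convert IsSemilinearSet.image hL (weight φ) using 1
  ext m
  constructor
  · rintro ⟨w, hw, rfl⟩
    exact ⟨_, ⟨w, hw, rfl⟩, weight_parikh φ w⟩
  · rintro ⟨_, ⟨w, hw, rfl⟩, rfl⟩
    exact ⟨w, hw, (weight_parikh φ w).symm⟩

/-- A letter-to-letter or erasing homomorphism preserves semilinearity. -/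
theorem IsSemilinearLanguage.filterMap {β : Type} [Finite α] {L : Language α}
    (hL : IsSemilinearLanguage L) (f : α → Option β) :
    IsSemilinearLanguage ({v | ∃ w ∈ L, w.filterMap f = v} : Language β) := by
  classical
  have key (w : List α) : (w.map fun a =>
      ((f a).elim 0 fun b => Pi.single b 1 : β → ℕ)).sum = parikh (w.filterMap f) := by
    induction w with
    | nil => simp [parikh_nil]
    | cons a w ih =>
      rw [List.map_cons, List.sum_cons, ih, List.filterMap_cons]
      cases f a <;> simp [parikh_cons]
  refine .of_forall (hL.image_sum (fun a => ((f a).elim 0 fun b => Pi.single b 1 : β → ℕ)))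
    fun m => ?_
  constructor
  · rintro ⟨_, ⟨w, hw, rfl⟩, rfl⟩
    exact ⟨w, hw, key w⟩
  · rintro ⟨w, hw, rfl⟩
    exact ⟨_, ⟨w, hw, rfl⟩, (key w).symm⟩

/-- Restricting the Parikh vectors of a semilinear language to a semilinear set. -/
theorem IsSemilinearLanguage.inf_parikh {L : Language α} (hL : IsSemilinearLanguage L)
    {T : Set (α → ℕ)} (hT : IsSemilinearSet T) :
    IsSemilinearLanguage (L ⊓ {w | parikh w ∈ T}) := by
  refine .of_forall (IsSemilinearSet.inter hL hT) fun v => ?_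
  constructor
  · rintro ⟨w, ⟨hw, hT⟩, rfl⟩
    exact ⟨⟨w, hw, rfl⟩, hT⟩
  · rintro ⟨⟨w, hw, rfl⟩, hT⟩
    exact ⟨w, ⟨hw, hT⟩, rfl⟩

end Weight

/-! ### Sums along paths in a finite labelled graph -/

section PathSum

variable {Q M : Type} [AddCommMonoid M]

/-- `PathSum S U p q m`: `m` is the sum of labels along a nonempty path from `p` to `q` with all
intermediate states in `U`, where an edge from `p` to `q` is labelled by an element of `S p q`. -/
inductive PathSum (S : Q → Q → Set M) (U : Set Q) : Q → Q → M → Prop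
  | single {p q : Q} {m : M} (h : m ∈ S p q) : PathSum S U p q m
  | cons {p r q : Q} {m n : M} (h : m ∈ S p r) (hr : r ∈ U) (ht : PathSum S U r q n) :
      PathSum S U p q (m + n)

namespace PathSum

variable {S : Q → Q → Set M} {U V : Set Q} {p q r : Q} {m n : M}

theorem mono (hUV : U ⊆ V) (h : PathSum S U p q m) : PathSum S V p q m := by
  induction h with
  | single h => exact .single h
  | cons h hr _ ih => exact .cons h (hUV hr) ih

theorem trans (h₁ : PathSum S U p r m) (hr : r ∈ U) (h₂ : PathSum S U r q n) :
    PathSum S U p q (m + n) := by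
  induction h₁ with
  | single h => exact .cons h hr h₂
  | cons h hr' _ ih =>
    rw [add_assoc]
    exact .cons h hr' (ih hr h₂)

open Pointwise in
/-- Kleene's recursion for path sums. -/
theorem insert_eq : {m | PathSum S (insert r U) p q m} = {m | PathSum S U p q m} ∪
    ({m | PathSum S U p r m} + (AddSubmonoid.closure {m | PathSum S U r r m} : Set M) +
      {m | PathSum S U r q m}) := by
  ext m
  constructor
  · intro h
    induction h with
    | single h => exact Or.inl (.single h)
    | @cons p r' q m n h hr' _ ih =>
      rcases hr' with rfl | hr'
      -- The first edge already ends at `r`, so it is the entire initial piece. Any initial piece of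
      -- the remaining path becomes one more loop at `r`.
      · right
        rcases ih with ih | ⟨_, ⟨a, ha, c, hc, rfl⟩, b, hb, rfl⟩
        · exact ⟨m, ⟨m, .single h, 0, AddSubmonoid.zero_mem _, add_zero m⟩, n, ih, rfl⟩
        · exact ⟨_, ⟨m, .single h, a + c, AddSubmonoid.add_mem _ (AddSubmonoid.subset_closure ha) hc,
            rfl⟩, b, hb, add_assoc _ _ _⟩
      · rcases ih with ih | ⟨_, ⟨a, ha, c, hc, rfl⟩, b, hb, rfl⟩
        · exact Or.inl (.cons h hr' ih)
        · exact Or.inr ⟨_, ⟨m + a, .cons h hr' ha, c, hc, rfl⟩, b, hb, by simp only [add_assoc]⟩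
  · have hU : U ⊆ insert r U := Set.subset_insert r U
    have hr : r ∈ insert r U := Set.mem_insert r U
    rintro (h | ⟨_, ⟨a, ha, c, hc, rfl⟩, b, hb, rfl⟩)
    · exact mono hU h
    · simp only [add_assoc]
      refine trans (mono hU ha) hr ?_
      have hb' : PathSum S (insert r U) r q b := mono hU hb
      clear hb
      induction hc using AddSubmonoid.closure_induction generalizing b with
      | mem x hx => exact trans (mono hU hx) hr hb'
      | zero => simpa using hb'
      | add x y _ _ ihx ihy =>
        rw [add_assoc]
        exact ihx _ (ihy _ hb')

/-- Intermediate states are admitted one at a time. Kleene's recursion uses only unions, sums and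
generated submonoids, all of which preserve semilinearity. -/
theorem isSemilinearSet [Finite Q] (hS : ∀ p q, IsSemilinearSet (S p q)) (p q : Q) :
    IsSemilinearSet {m | PathSum S Set.univ p q m} := by
  suffices ∀ U : Set Q, ∀ p q, IsSemilinearSet {m | PathSum S U p q m} from this _ p q
  intro U
  induction U, U.toFinite using Set.Finite.induction_on with
  | empty =>
    intro p q
    convert hS p q using 1
    ext m
    refine ⟨fun h => ?_, .single⟩
    cases h with
    | single h => exact h
    | cons _ hr _ => exact hr.elim
  | insert _ _ ih =>
    intro p q
    rw [insert_eq]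
    exact (ih p q).union (((ih _ _).add (ih _ _).closure).add (ih _ _))

end PathSum

end PathSum

/-! ### Regular languages and Parikh's theorem for them -/

section PartialDFA

variable {α σ : Type}

/-- The automaton of a partial transition function; `none` is a dead state. -/
def partialDFA (f : σ → α → Option σ) (s : σ) (F : Set σ) : DFA α (Option σ) where
  step o a := o.bind fun s => f s a
  start := some s
  accept := some '' F

theorem partialDFA_evalFrom_none (f : σ → α → Option σ) (s : σ) (F : Set σ) (x : List α) :
    (partialDFA f s F).evalFrom none x = none := by
  induction x with
  | nil => rfl
  | cons a x ih => exact ih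

/-- Membership in the language of a partial transition function, from any state. -/
def partialAccepts (f : σ → α → Option σ) (F : Set σ) : σ → List α → Prop
  | s, [] => s ∈ F
  | s, a :: x => ∃ t, f s a = some t ∧ partialAccepts f F t x

theorem partialDFA_mem_acceptsFrom (f : σ → α → Option σ) (s₀ s : σ) (F : Set σ) (x : List α) :
    x ∈ (partialDFA f s₀ F).acceptsFrom (some s) ↔ partialAccepts f F s x := by
  induction x generalizing s with
  | nil => simp [DFA.mem_acceptsFrom, partialDFA, partialAccepts]
  | cons a x ih =>
    rw [DFA.mem_acceptsFrom, DFA.evalFrom_cons]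
    change (partialDFA f s₀ F).evalFrom (f s a) x ∈ _ ↔ ∃ t, f s a = some t ∧ _
    cases h : f s a with
    | none =>
      rw [partialDFA_evalFrom_none]
      simp [partialDFA]
    | some t => simpa [DFA.mem_acceptsFrom] using ih t

/-- A partial transition function with finitely many reachable states accepts a regular
language. -/
theorem isRegular_partialAccepts (f : σ → α → Option σ) (F : Set σ) (s : σ) {T : Set σ}
    (hT : T.Finite) (hs : s ∈ T) (hf : ∀ s ∈ T, ∀ a, ∀ t, f s a = some t → t ∈ T) :
    Language.IsRegular ({x | partialAccepts f F s x} : Language α) := by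
  have h : ({x | partialAccepts f F s x} : Language α) = (partialDFA f s F).accepts := by
    ext x
    exact (partialDFA_mem_acceptsFrom f s s F x).symm
  rw [h]
  -- `σ` may be infinite, so regularity comes from Myhill–Nerode: a left quotient depends only on
  -- the state reached.
  apply Language.IsRegular.of_finite_range_leftQuotient
  have hreach (x : List α) : (partialDFA f s F).eval x ∈ insert none (some '' T) := by
    induction x using List.reverseRecOn with
    | nil => exact Or.inr ⟨s, hs, rfl⟩
    | append_singleton x a ih =>
      rw [DFA.eval_append_singleton]
      rcases ih with ih | ⟨t, ht, ih⟩
      · rw [ih]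
        exact Or.inl rfl
      · rw [← ih]
        change f t a ∈ _
        cases h : f t a with
        | none => exact Or.inl rfl
        | some r => exact Or.inr ⟨r, hf t ht a r h, rfl⟩
  refine ((hT.image some).insert none).image (partialDFA f s F).acceptsFrom |>.subset ?_
  rintro _ ⟨x, rfl⟩
  rw [Language.leftQuotient_accepts]
  exact ⟨_, hreach x, rfl⟩

theorem isRegular_congr {R S : Language α} (hR : R.IsRegular) (h : ∀ w, w ∈ R ↔ w ∈ S) :
    S.IsRegular :=
  (Set.ext h : R = S) ▸ hR

theorem isRegular_singleton_nil : Language.IsRegular ({[]} : Language α) := by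
  refine isRegular_congr (isRegular_partialAccepts (fun (_ : Unit) (_ : α) => none) {()} ()
    (Set.toFinite {()}) rfl (by simp)) fun x => ?_
  cases x with
  | nil => exact ⟨fun _ => rfl, fun _ => rfl⟩
  | cons a x => exact iff_of_false (fun ⟨_, h, _⟩ => nomatch h) (fun h => nomatch h)

theorem isRegular_top : Language.IsRegular (⊤ : Language α) :=
  ⟨Unit, inferInstance, ⟨fun _ _ => (), (), Set.univ⟩, by
    ext x
    exact iff_of_true trivial trivial⟩

theorem isRegular_homPreimage {β : Type} (h : α → List β) {R : Language β} (hR : R.IsRegular) :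
    (homPreimage h R).IsRegular := by
  obtain ⟨Q, hQ, A, rfl⟩ := hR
  refine ⟨Q, hQ, ⟨fun q a => A.evalFrom q (h a), A.start, A.accept⟩, ?_⟩
  ext w
  change List.foldl _ A.start w ∈ A.accept ↔ A.evalFrom A.start (w.flatMap h) ∈ A.accept
  suffices ∀ q, List.foldl (fun q a => A.evalFrom q (h a)) q w = A.evalFrom q (w.flatMap h) by
    rw [this]
  induction w with
  | nil => simp
  | cons a w ih =>
    intro q
    rw [List.foldl_cons, ih, List.flatMap_cons, DFA.evalFrom_of_append]

theorem flatMap_toList {β : Type} (f : α → Option β) (w : List α) :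
    (w.flatMap fun a => (f a).toList) = w.filterMap f := by
  induction w with
  | nil => rfl
  | cons a w ih => rw [List.flatMap_cons, ih, List.filterMap_cons]; cases f a <;> rfl

theorem isRegular_filterMap_mem {β : Type} (f : α → Option β) {R : Language β}
    (hR : R.IsRegular) : Language.IsRegular ({w | w.filterMap f ∈ R} : Language α) := by
  refine isRegular_congr (isRegular_homPreimage (fun a => (f a).toList) hR) fun w => ?_
  change (w.flatMap fun a => (f a).toList) ∈ R ↔ w.filterMap f ∈ R
  rw [flatMap_toList]

/-- Parikh's theorem for regular languages. -/
theorem isSemilinearLanguage_of_isRegular [Finite α] {R : Language α} (hR : R.IsRegular) :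
    IsSemilinearLanguage R := by
  classical
  obtain ⟨Q, hQ, A, rfl⟩ := hR
  let S : Q → Q → Set (α → ℕ) := fun p q => {m | ∃ a, A.step p a = q ∧ Pi.single a 1 = m}
  have hS (p q) : IsSemilinearSet (S p q) :=
    .of_finite ((Set.finite_range fun a : α => (Pi.single a 1 : α → ℕ)).subset
      (by rintro _ ⟨a, _, rfl⟩; exact ⟨a, rfl⟩))
  have h₁ (w : List α) (a p) :
      PathSum S Set.univ p (A.evalFrom p (a :: w)) (parikh (a :: w)) := by
    induction w generalizing a p with
    | nil =>
      rw [parikh_cons, parikh_nil, add_zero]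
      exact .single ⟨a, rfl, rfl⟩
    | cons b w ih =>
      rw [parikh_cons a]
      exact .cons ⟨a, rfl, rfl⟩ trivial (ih b _)
  have h₂ (p q m) (h : PathSum S Set.univ p q m) : ∃ w, A.evalFrom p w = q ∧ parikh w = m := by
    induction h with
    | single h =>
      obtain ⟨a, rfl, rfl⟩ := h
      exact ⟨[a], rfl, by rw [parikh_cons, parikh_nil, add_zero]⟩
    | cons h _ _ ih =>
      obtain ⟨a, rfl, rfl⟩ := h
      obtain ⟨w, rfl, rfl⟩ := ih
      exact ⟨a :: w, rfl, parikh_cons a w⟩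
  -- Path sums have at least one edge, so the empty word is treated separately.
  have h₃ : IsSemilinearSet ({m | m = 0 ∧ A.start ∈ A.accept} ∪
      ⋃ q ∈ A.accept, {m | PathSum S Set.univ A.start q m}) :=
    (IsSemilinearSet.of_finite ((Set.finite_singleton 0).subset fun m hm => hm.1)).union
      (.biUnion (Set.toFinite _) fun q _ => PathSum.isSemilinearSet hS _ _)
  refine .of_forall h₃ fun m => ?_
  constructor
  · rintro ⟨w, hw, rfl⟩
    cases w with
    | nil => exact Or.inl ⟨parikh_nil, hw⟩
    | cons a w => exact Or.inr (Set.mem_biUnion (show A.evalFrom A.start (a :: w) ∈ A.accept from hw)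
        (h₁ w a _))
  · rintro (⟨rfl, h⟩ | h)
    · exact ⟨[], h, parikh_nil⟩
    · obtain ⟨q, hq, h⟩ := Set.mem_iUnion₂.1 h
      obtain ⟨w, rfl, rfl⟩ := h₂ _ _ _ h
      exact ⟨w, hq, rfl⟩

end PartialDFA

end LanguageFamily

namespace LanguageFamily

/-! ### Interleavings that equate two homomorphic images -/

section Sync

variable {A B C : Type}

open scoped Classical in
/-- A buffer that is filled with `h a` on reading `a : A` (when empty) and from which `g c` is
removed on reading `c : C`. -/
noncomputable def syncStep (h : A → List B) (g : C → Option B) : List B → A ⊕ C → Option (List B)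
  | [], .inl a => some (h a)
  | _ :: _, .inl _ => none
  | v, .inr c => (g c).elim (some v) fun b => if v.head? = some b then some v.tail else none

/-- Interleavings of words over `A` and `C` with the same image under `h` and `g`. -/
def sync (h : A → List B) (g : C → Option B) : Language (A ⊕ C) :=
  {x | partialAccepts (syncStep h g) {[]} [] x}

/-- The buffer is filled only when empty, so its length never exceeds that of a single `h a`, and
only finitely many buffers are reachable. -/
theorem isRegular_sync [Finite A] [Finite B] (h : A → List B) (g : C → Option B) :
    (sync h g).IsRegular := by
  have : Fintype A := Fintype.ofFinite A
  let n := ∑ a, (h a).length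
  refine isRegular_partialAccepts _ _ _ (List.finite_length_le B n) (Nat.zero_le n) ?_
  intro v hv x t hx
  rcases x with a | c
  · cases v with
    | nil =>
      obtain rfl := Option.some.inj hx
      exact Finset.single_le_sum (f := fun a => (h a).length) (fun _ _ => Nat.zero_le _)
        (Finset.mem_univ a)
    | cons b v => cases hx
  · rw [syncStep] at hx
    cases hc : g c with
    | none =>
      rw [hc] at hx
      obtain rfl := Option.some.inj hx
      exact hv
    | some b =>
      simp only [hc, Option.elim_some, Option.ite_none_right_eq_some, Option.some.injEq] at hx
      obtain ⟨_, rfl⟩ := hx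
      have : v.length ≤ n := hv
      change v.tail.length ≤ n
      grind

/-- The buffer holds the part of the image already produced by the left letters and not yet consumed
by the right ones. -/
theorem syncStep_sound {h : A → List B} {g : C → Option B} {v : List B} {x : List (A ⊕ C)}
    (hx : partialAccepts (syncStep h g) {[]} v x) :
    v ++ (x.filterMap Sum.getLeft?).flatMap h = (x.filterMap Sum.getRight?).filterMap g := by
  induction x generalizing v with
  | nil =>
    obtain rfl : v = [] := hx
    rfl
  | cons y x ih =>
    obtain ⟨t, ht, hx⟩ := hx
    have := ih hx
    rcases y with a | c
    · cases v with
      | nil =>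
        obtain rfl := Option.some.inj ht
        simpa [List.filterMap_cons] using this
      | cons b v => cases ht
    · rw [syncStep] at ht
      cases hc : g c with
      | none =>
        rw [hc] at ht
        obtain rfl := Option.some.inj ht
        simpa [List.filterMap_cons, hc] using this
      | some b =>
        simp only [hc, Option.elim_some, Option.ite_none_right_eq_some, Option.some.injEq] at ht
        obtain ⟨hb, rfl⟩ := ht
        cases v with
        | nil => cases hb
        | cons b' v =>
          obtain rfl := Option.some.inj hb
          simpa [List.filterMap_cons, hc] using this

/-- A schedule is built by induction on the number of letters left: while right letters remain, a
left letter is read only if the next right letter needs a symbol and the buffer is empty. Once they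
run out, the buffer and the remaining image are empty, so the left letters can be read freely. -/
theorem syncStep_complete {h : A → List B} {g : C → Option B} (n : ℕ) :
    ∀ {v : List B} {w : List A} {u : List C}, w.length + u.length = n →
      v ++ w.flatMap h = u.filterMap g → ∃ x, partialAccepts (syncStep h g) {[]} v x ∧
        x.filterMap Sum.getLeft? = w ∧ x.filterMap Sum.getRight? = u := by
  induction n with
  | zero =>
    intro v w u hn hv
    obtain rfl : w = [] := List.length_eq_zero_iff.1 (by omega)
    obtain rfl : u = [] := List.length_eq_zero_iff.1 (by omega)
    obtain rfl : v = [] := by simpa using hv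
    exact ⟨[], rfl, rfl, rfl⟩
  | succ n ih =>
    intro v w u hn hv
    have left (a : A) (w' : List A) (hw : w = a :: w') (hv' : v = []) :
        ∃ x, partialAccepts (syncStep h g) {[]} v x ∧
          x.filterMap Sum.getLeft? = w ∧ x.filterMap Sum.getRight? = u := by
      subst hw hv'
      obtain ⟨x, hx, hw, hu⟩ := ih (v := h a) (w := w') (u := u) (by simp at hn; omega)
        (by simpa using hv)
      exact ⟨.inl a :: x, ⟨h a, rfl, hx⟩, by simp [hw], by simp [List.filterMap_cons, hu]⟩
    cases u with
    | nil =>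
      have hv' : v ++ w.flatMap h = [] := hv
      rw [List.append_eq_nil_iff] at hv'
      cases w with
      | nil => simp at hn
      | cons a w => exact left a w rfl hv'.1
    | cons c u =>
      cases hc : g c with
      | none =>
        obtain ⟨x, hx, hw, hu⟩ := ih (v := v) (w := w) (u := u) (by simp at hn; omega)
          (by simpa [List.filterMap_cons, hc] using hv)
        exact ⟨.inr c :: x, ⟨v, by simp [syncStep, hc], hx⟩, by simp [List.filterMap_cons, hw], by simp [hu]⟩
      | some b =>
        simp only [List.filterMap_cons, hc] at hv
        cases v with
        | nil =>
          cases w with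
          | nil => simp at hv
          | cons a w => exact left a w rfl rfl
        | cons b' v =>
          simp only [List.cons_append, List.cons.injEq] at hv
          obtain ⟨rfl, hv⟩ := hv
          obtain ⟨x, hx, hw, hu⟩ := ih (v := v) (w := w) (u := u) (by simp at hn; omega) hv
          exact ⟨.inr c :: x, ⟨v, by simp [syncStep, hc], hx⟩, by simp [List.filterMap_cons, hw], by simp [hu]⟩

theorem exists_mem_sync_iff {h : A → List B} {g : C → Option B} {w : List A} {u : List C} :
    (∃ x ∈ sync h g, x.filterMap Sum.getLeft? = w ∧ x.filterMap Sum.getRight? = u) ↔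
      w.flatMap h = u.filterMap g := by
  constructor
  · rintro ⟨x, hx, rfl, rfl⟩
    exact syncStep_sound hx
  · exact syncStep_complete (v := []) _ rfl

end Sync

/-- The languages all of whose inverse homomorphic images, intersected with regular languages, are
semilinear. -/
def hereditary : LanguageFamily := fun α _ =>
  {L | ∀ (D : Type) [Finite D] (h : D → List α) (R : Language D), R.IsRegular →
    IsSemilinearLanguage (homPreimage h L ⊓ R)}

/-- The words that lead from state `p` to state `q` form a regular language. -/
theorem isRegular_evalFrom_eq {D Q : Type} [Finite Q] (A : DFA D Q) (p q : Q) :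
    Language.IsRegular ({u | A.evalFrom p u = q} : Language D) :=
  ⟨Q, Fintype.ofFinite Q, ⟨A.step, p, {q}⟩, rfl⟩

/-! ### Closure properties of the hereditary family -/

section Closure

variable {α : Type} [Finite α]

/-- A general homomorphism `h` reduces to letter-or-erase maps: interleave u with its image h(u),
test membership in `L` on the right letters, and project to the left ones. -/
theorem hereditary_of_filterMap {L : Language α}
    (hL : ∀ (D : Type) [Finite D] (g : D → Option α) (R : Language D), R.IsRegular →
      IsSemilinearLanguage ({u | u.filterMap g ∈ L ∧ u ∈ R} : Language D)) :
    L ∈ hereditary α := by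
  intro D _ h R hR
  refine ((hL (D ⊕ α) Sum.getRight? (sync h some ⊓ {x | x.filterMap Sum.getLeft? ∈ R})
    ((isRegular_sync h some).inf (isRegular_filterMap_mem _ hR))).filterMap Sum.getLeft?).congr ?_
  intro u
  constructor
  · rintro ⟨x, ⟨hxL, hx, hxR⟩, rfl⟩
    have := exists_mem_sync_iff.1 ⟨x, hx, rfl, rfl⟩
    rw [List.filterMap_some] at this
    exact ⟨show List.flatMap _ _ ∈ L from this ▸ hxL, hxR⟩
  · rintro ⟨huL, huR⟩
    obtain ⟨x, hx, rfl, hxu⟩ := (exists_mem_sync_iff (h := h) (g := some) (w := u)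
      (u := u.flatMap h)).2 (by rw [List.filterMap_some])
    exact ⟨x, ⟨show _ ∈ L from hxu ▸ huL, hx, huR⟩, rfl⟩

theorem hereditary.filterMap {L : Language α} (hL : L ∈ hereditary α) {D : Type} [Finite D]
    (g : D → Option α) {R : Language D} (hR : R.IsRegular) :
    IsSemilinearLanguage ({u | u.filterMap g ∈ L ∧ u ∈ R} : Language D) := by
  refine (hL D (fun d => (g d).toList) R hR).congr fun u => ?_
  change ((u.flatMap fun d => (g d).toList) ∈ L ∧ _) ↔ _
  rw [flatMap_toList]
  rfl

/-- A word u has g(u) in h(L) exactly when some w in L satisfies h(w) = g(u). Interleaving w with u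
makes this an inverse image of `L` cut by a regular language, which is then projected to u. -/
theorem hereditary.homImage {β : Type} [Finite β] {L : Language α} (hL : L ∈ hereditary α)
    (h : α → List β) : LanguageFamily.homImage h L ∈ hereditary β := by
  refine hereditary_of_filterMap fun D _ g R hR => ?_
  refine ((hereditary.filterMap hL Sum.getLeft? (R := sync h g ⊓ {x | x.filterMap Sum.getRight? ∈ R})
    ((isRegular_sync h g).inf (isRegular_filterMap_mem _ hR))).filterMap Sum.getRight?).congr ?_
  intro u
  constructor
  · rintro ⟨x, ⟨hxL, hx, hxR⟩, rfl⟩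
    exact ⟨⟨_, hxL, exists_mem_sync_iff.1 ⟨x, hx, rfl, rfl⟩⟩, hxR⟩
  · rintro ⟨⟨w, hw, hwu⟩, huR⟩
    obtain ⟨x, hx, rfl, rfl⟩ := exists_mem_sync_iff.2 hwu
    exact ⟨x, ⟨hw, hx, huR⟩, rfl⟩

theorem hereditary.homPreimage {β : Type} [Finite β] {L : Language β} (hL : L ∈ hereditary β)
    (h : α → List β) : LanguageFamily.homPreimage h L ∈ hereditary α := by
  intro D _ k R hR
  refine (hL D (fun d => (k d).flatMap h) R hR).congr fun u => ?_
  change (_ ∈ L ∧ _) ↔ (_ ∈ L ∧ _)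
  rw [List.flatMap_assoc]

theorem hereditary.inf_isRegular {L : Language α} (hL : L ∈ hereditary α) {R : Language α}
    (hR : R.IsRegular) : L ⊓ R ∈ hereditary α := by
  intro D _ h R' hR'
  exact (hL D h _ ((isRegular_homPreimage h hR).inf hR')).congr fun u => and_assoc.symm

/-- The Parikh vector of h(u) is a linear function of that of u, so the constraint pulls back to a
semilinear one. -/
theorem hereditary.inf_parikh {L : Language α} (hL : L ∈ hereditary α) {T : Set (α → ℕ)}
    (hT : IsSemilinearSet T) : L ⊓ {w | parikh w ∈ T} ∈ hereditary α := by
  intro D _ h R hR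
  have key (u : List D) : parikh (u.flatMap h) = weight (fun d => parikh (h d)) (parikh u) := by
    rw [weight_parikh]
    induction u with
    | nil => exact parikh_nil
    | cons d u ih => rw [List.flatMap_cons, parikh_append, ih, List.map_cons, List.sum_cons]
  refine ((hL D h R hR).inf_parikh (hT.preimage (weight fun d => parikh (h d)))).congr fun u => ?_
  change ((_ ∧ _) ∧ weight (fun d => parikh (h d)) (parikh u) ∈ T) ↔
    ((_ ∧ parikh (u.flatMap h) ∈ T) ∧ _)
  rw [key]
  exact and_right_comm

theorem hereditary.sup {L₁ L₂ : Language α} (h₁ : L₁ ∈ hereditary α) (h₂ : L₂ ∈ hereditary α) :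
    L₁ ⊔ L₂ ∈ hereditary α := by
  intro D _ h R hR
  refine .of_forall (IsSemilinearSet.union (h₁ D h R hR) (h₂ D h R hR)) fun v => ?_
  constructor
  · rintro ⟨w, ⟨hw | hw, hR⟩, rfl⟩
    · exact Or.inl ⟨w, ⟨hw, hR⟩, rfl⟩
    · exact Or.inr ⟨w, ⟨hw, hR⟩, rfl⟩
  · rintro (⟨w, ⟨hw, hR⟩, rfl⟩ | ⟨w, ⟨hw, hR⟩, rfl⟩)
    · exact ⟨w, ⟨Or.inl hw, hR⟩, rfl⟩
    · exact ⟨w, ⟨Or.inr hw, hR⟩, rfl⟩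

theorem hereditary.isSemilinearSet_evalFrom {L : Language α} (hL : L ∈ hereditary α) {D Q : Type}
    [Finite D] [Finite Q] (g : D → Option α) (A : DFA D Q) (p q : Q) :
    IsSemilinearSet {m | ∃ u : List D, u.filterMap g ∈ L ∧ A.evalFrom p u = q ∧ parikh u = m} := by
  have : IsSemilinearSet _ := hereditary.filterMap hL g (isRegular_evalFrom_eq A p q)
  convert this using 1
  ext m
  exact exists_congr fun u => and_assoc.symm

-- Splitting by the DFA state `r` at the cut makes the two factors independent, so the Parikh image
-- is a finite union of sums.
open Pointwise in
theorem hereditary.mul {L₁ L₂ : Language α} (h₁ : L₁ ∈ hereditary α) (h₂ : L₂ ∈ hereditary α) :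
    L₁ * L₂ ∈ hereditary α := by
  refine hereditary_of_filterMap fun D _ g R hR => ?_
  obtain ⟨Q, _, A, rfl⟩ := hR
  refine .of_forall (IsSemilinearSet.iUnion fun r : Q => .biUnion (Set.toFinite A.accept)
    fun q _ => (hereditary.isSemilinearSet_evalFrom h₁ g A A.start r).add
      (hereditary.isSemilinearSet_evalFrom h₂ g A r q)) fun m => ?_
  simp only [Set.mem_iUnion, Set.mem_add, exists_prop]
  constructor
  · rintro ⟨u, ⟨hu, hA⟩, rfl⟩
    obtain ⟨w₁, hw₁, w₂, hw₂, hw⟩ := Language.mem_mul.1 hu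
    obtain ⟨u₁, u₂, rfl, rfl, rfl⟩ := List.filterMap_eq_append_iff.1 hw.symm
    exact ⟨_, _, hA, _, ⟨u₁, hw₁, rfl, rfl⟩, _,
      ⟨u₂, hw₂, (A.evalFrom_of_append _ _ _).symm, rfl⟩, (parikh_append _ _).symm⟩
  · rintro ⟨r, q, hq, _, ⟨u₁, hu₁, rfl, rfl⟩, _, ⟨u₂, hu₂, rfl, rfl⟩, rfl⟩
    refine ⟨u₁ ++ u₂, ⟨?_, ?_⟩, parikh_append _ _⟩
    · rw [List.filterMap_append]
      exact Language.append_mem_mul hu₁ hu₂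
    · change A.evalFrom A.start (u₁ ++ u₂) ∈ A.accept
      rwa [A.evalFrom_of_append]

/-- The factors of a word become edges between the DFA states at the cuts, so Parikh vectors are
path sums. -/
theorem hereditary.kstar {L : Language α} (hL : L ∈ hereditary α) :
    KStar.kstar L ∈ hereditary α := by
  refine hereditary_of_filterMap fun D _ g R hR => ?_
  -- With zero factors, u need not be empty, only erased by `g`; such words form a regular language.
  have hE : IsSemilinearLanguage ({u | u.filterMap g = [] ∧ u ∈ R} : Language D) :=
    isSemilinearLanguage_of_isRegular
      ((isRegular_filterMap_mem g isRegular_singleton_nil).inf hR)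
  obtain ⟨Q, _, A, rfl⟩ := hR
  let S : Q → Q → Set (D → ℕ) := fun p q =>
    {m | ∃ u : List D, u.filterMap g ∈ L ∧ A.evalFrom p u = q ∧ parikh u = m}
  have hS (p q) : IsSemilinearSet (S p q) := hereditary.isSemilinearSet_evalFrom hL g A p q
  have h₁ (w : List α) (hw : w ∈ L) (ws : List (List α)) (hws : ∀ y ∈ ws, y ∈ L) (u : List D) (p : Q)
      (hu : u.filterMap g = (w :: ws).flatten) :
      PathSum S Set.univ p (A.evalFrom p u) (parikh u) := by
    induction ws generalizing w u p with
    | nil => exact .single ⟨u, by simpa [hu] using hw, rfl, rfl⟩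
    | cons w' ws ih =>
      rw [List.flatten_cons] at hu
      obtain ⟨u₁, u₂, rfl, rfl, hu₂⟩ := List.filterMap_eq_append_iff.1 hu
      rw [parikh_append, A.evalFrom_of_append]
      exact .cons ⟨u₁, hw, rfl, rfl⟩ trivial
        (ih w' (hws _ (by simp)) (fun y hy => hws y (by simp [hy])) _ _ hu₂)
  have h₂ (p q m) (h : PathSum S Set.univ p q m) :
      ∃ u : List D, u.filterMap g ∈ KStar.kstar L ∧ A.evalFrom p u = q ∧ parikh u = m := by
    induction h with
    | single h =>
      obtain ⟨u, hu, rfl, rfl⟩ := h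
      exact ⟨u, Language.mem_kstar.2 ⟨[u.filterMap g], by simp, by simpa using hu⟩, rfl, rfl⟩
    | cons h _ _ ih =>
      obtain ⟨u, hu, rfl, rfl⟩ := h
      obtain ⟨v, hv, rfl, rfl⟩ := ih
      refine ⟨u ++ v, ?_, A.evalFrom_of_append _ _ _, parikh_append _ _⟩
      obtain ⟨ws, hws, hws'⟩ := Language.mem_kstar.1 hv
      refine Language.mem_kstar.2 ⟨u.filterMap g :: ws, ?_, ?_⟩
      · rw [List.filterMap_append, hws, List.flatten_cons]
      · simpa [hu] using hws'
  refine .of_forall (IsSemilinearSet.union hE (.biUnion (Set.toFinite A.accept) fun q _ =>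
    PathSum.isSemilinearSet hS A.start q)) fun m => ?_
  constructor
  · rintro ⟨u, ⟨hu, hA⟩, rfl⟩
    obtain ⟨ws, hu, hws⟩ := Language.mem_kstar.1 hu
    cases ws with
    | nil => exact Or.inl ⟨u, ⟨hu, hA⟩, rfl⟩
    | cons w ws =>
      exact Or.inr (Set.mem_biUnion (show A.evalFrom A.start u ∈ A.accept from hA)
        (h₁ w (hws _ (by simp)) ws (fun y hy => hws y (by simp [hy])) u _ hu))
  · rintro (⟨u, ⟨hu, hA⟩, rfl⟩ | h)
    · exact ⟨u, ⟨show _ ∈ KStar.kstar L from hu ▸ Language.nil_mem_kstar L, hA⟩, rfl⟩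
    · obtain ⟨q, hq, h⟩ := Set.mem_iUnion₂.1 h
      obtain ⟨u, hu, rfl, rfl⟩ := h₂ _ _ _ h
      exact ⟨u, ⟨hu, hq⟩, rfl⟩

end Closure

theorem isFullAFL_hereditary : hereditary.IsFullAFL where
  hom h _ hL := hereditary.homImage hL h
  invHom h _ hL := hereditary.homPreimage hL h
  interRegular _ hL _ hR := hereditary.inf_isRegular hL hR
  union _ h₁ _ h₂ := hereditary.sup h₁ h₂
  concat _ h₁ _ h₂ := hereditary.mul h₁ h₂
  star _ hL := hereditary.kstar hL

theorem isSemilinear_hereditary : hereditary.IsSemilinear := by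
  intro α _ L hL
  refine (hereditary.filterMap hL some isRegular_top).congr fun w => ?_
  change (w.filterMap some ∈ L ∧ True) ↔ w ∈ L
  rw [List.filterMap_some, and_true]

theorem contained_hereditary {F : LanguageFamily} (hF : F.IsFullTrio) (hsemi : F.IsSemilinear) :
    F.Contained hereditary :=
  fun _ _ L hL D _ h R hR => hsemi D _ (hF.interRegular _ (hF.invHom h L hL) R hR)

end LanguageFamily

namespace CounterMachine

/-! ### Segments of the history of one counter -/

section Segments

/-- Segment `s` of a computation is of one of five kinds, for the behaviour of one counter: it stays
zero, leaves zero, is positive and non-decreasing, is positive and non-increasing, reaches zero.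
This is the restriction on the updates `d` in segment `s`. -/
def UpdateFits (s : ℕ) (d : ℤ) : Prop :=
  (s % 5 = 0 → d = 0) ∧ (s % 5 = 1 → d = 1) ∧ (s % 5 = 2 → 0 ≤ d) ∧ (s % 5 = 3 → d ≤ 0) ∧
    (s % 5 = 4 → d = -1)

/-- The restriction on the counter values `v` and `v'` before and after segment `s`, or before and
after a move in it. -/
def ValuesFit (s : ℕ) (v v' : ℤ) : Prop :=
  (s % 5 = 0 → v = 0) ∧ (s % 5 = 1 → v = 0 ∧ v' = 1) ∧ (s % 5 = 2 → 1 ≤ v) ∧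
    (s % 5 = 3 → 1 ≤ v') ∧ (s % 5 = 4 → v = 1 ∧ v' = 0)

/-- A sequence of updates of a counter with value `c`, each with its segment, in which every move
fits its segment. -/
def Tracks : ℤ → List (ℕ × ℤ) → Prop
  | _, [] => True
  | c, e :: y => ValuesFit e.1 c (c + e.2) ∧ Tracks (c + e.2) y

/-- The sum of the updates in segments before `s`. -/
def sumBelow (s : ℕ) (y : List (ℕ × ℤ)) : ℤ :=
  (y.map fun e => if e.1 < s then e.2 else 0).sum

/-- The sum of the updates in segment `s`. -/
def sumAt (s : ℕ) (y : List (ℕ × ℤ)) : ℤ :=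
  (y.map fun e => if e.1 = s then e.2 else 0).sum

theorem sumBelow_cons (s : ℕ) (e : ℕ × ℤ) (y : List (ℕ × ℤ)) :
    sumBelow s (e :: y) = (if e.1 < s then e.2 else 0) + sumBelow s y := by
  simp [sumBelow]

theorem sumAt_cons (s : ℕ) (e : ℕ × ℤ) (y : List (ℕ × ℤ)) :
    sumAt s (e :: y) = (if e.1 = s then e.2 else 0) + sumAt s y := by
  simp [sumAt]

theorem sumBelow_append (s : ℕ) (y z : List (ℕ × ℤ)) :
    sumBelow s (y ++ z) = sumBelow s y + sumBelow s z := by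
  simp [sumBelow]

theorem sumBelow_succ (s : ℕ) (y : List (ℕ × ℤ)) :
    sumBelow (s + 1) y = sumBelow s y + sumAt s y := by
  induction y with
  | nil => rfl
  | cons e y ih =>
    rw [sumBelow_cons, sumBelow_cons, sumAt_cons, ih]
    grind

theorem sumBelow_eq_zero {s : ℕ} {y : List (ℕ × ℤ)} (h : ∀ e ∈ y, s ≤ e.1) : sumBelow s y = 0 := by
  induction y with
  | nil => rfl
  | cons e y ih =>
    rw [sumBelow_cons, ih fun e he => h e (by simp [he]), if_neg (not_lt.2 (h e (by simp)))]
    rfl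

theorem sum_eq_sumBelow_succ {s : ℕ} {y : List (ℕ × ℤ)} (h : ∀ e ∈ y, e.1 ≤ s) :
    (y.map Prod.snd).sum = sumBelow (s + 1) y := by
  induction y with
  | nil => rfl
  | cons e y ih =>
    rw [sumBelow_cons, ← ih fun e he => h e (by simp [he]),
      if_pos (Nat.lt_succ_of_le (h e (by simp))), List.map_cons, List.sum_cons]

theorem sumAt_sign {s : ℕ} {y : List (ℕ × ℤ)} (h : ∀ e ∈ y, UpdateFits e.1 e.2) :
    (s % 5 ≤ 2 → 0 ≤ sumAt s y) ∧ (3 ≤ s % 5 → sumAt s y ≤ 0) ∧ (s % 5 = 0 → sumAt s y = 0) := by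
  induction y with
  | nil => simp [sumAt]
  | cons e y ih =>
    have ih := ih fun e he => h e (by simp [he])
    have he := h e (by simp)
    rw [sumAt_cons]
    unfold UpdateFits at he
    split_ifs with hs
    · rw [hs] at he
      omega
    · simpa using ih

/-- If the values at the boundaries of the segments fit, then every move does. -/
theorem tracks_of_valuesFit {y : List (ℕ × ℤ)} (hy : y.Pairwise fun e e' => e.1 ≤ e'.1)
    (hd : ∀ e ∈ y, UpdateFits e.1 e.2)
    (hv : ∀ e ∈ y, ValuesFit e.1 (sumBelow e.1 y) (sumBelow (e.1 + 1) y)) : Tracks 0 y := by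
  suffices ∀ z x, y = x ++ z → Tracks (x.map Prod.snd).sum z from this y [] rfl
  intro z
  induction z with
  | nil => exact fun _ _ => trivial
  | cons e z ih =>
    intro x hx
    refine ⟨?_, ?_⟩
    -- Here `x` and `z` are the moves before and after `e`. Updates within a segment have constant
    -- sign, so the values around `e` lie between the boundary values. In kinds 1 and 4, steps of
    -- size one and boundary values differing by one leave room for no other move.
    · subst hx
      have he := hv e (by simp)
      have hde := hd e (by simp)
      have hdx := sumAt_sign (s := e.1) (y := x) fun e he => hd e (by simp [he])
      have hdz := sumAt_sign (s := e.1) (y := z) fun e he => hd e (by simp [he])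
      obtain ⟨-, h₂, h₃⟩ := List.pairwise_append.1 hy
      have hz : sumBelow e.1 z = 0 := sumBelow_eq_zero (List.pairwise_cons.1 h₂).1
      have hx := sum_eq_sumBelow_succ (s := e.1) (y := x) fun e' he' => h₃ e' he' e (by simp)
      rw [sumBelow_append, sumBelow_append, sumBelow_cons, sumBelow_cons, if_neg (lt_irrefl _),
        if_pos (Nat.lt_succ_self _), ← hx, sumBelow_succ, hz] at he
      rw [sumBelow_succ] at hx
      unfold ValuesFit UpdateFits at *
      omega
    · have := ih (x ++ [e]) (by simpa using hx)
      simpa using this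

/-- Look at the first move in segment `s`: all earlier moves lie in lower segments, so the value
before it is the left boundary value. -/
theorem valuesFit_left_of_tracks {y : List (ℕ × ℤ)} (hy : y.Pairwise fun e e' => e.1 ≤ e'.1)
    {c : ℤ} (h : Tracks c y) {s : ℕ} (hs : ∃ e ∈ y, e.1 = s) :
    ∃ v', ValuesFit s (c + sumBelow s y) v' := by
  induction y generalizing c with
  | nil => simp at hs
  | cons e y ih =>
    rw [List.pairwise_cons] at hy
    by_cases he : e.1 = s
    · subst he
      refine ⟨c + e.2, ?_⟩
      rw [sumBelow_eq_zero (by simpa using fun a b hab => hy.1 (a, b) hab), add_zero]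
      exact h.1
    · have hs' : ∃ e ∈ y, e.1 = s := by simpa [he] using hs
      obtain ⟨v', hv'⟩ := ih hy.2 h.2 hs'
      obtain ⟨e', he', rfl⟩ := hs'
      refine ⟨v', ?_⟩
      rwa [sumBelow_cons, if_pos (lt_of_le_of_ne (hy.1 e' he') he), ← add_assoc]

/-- Symmetrically, the last move in segment `s` ends at the right boundary value. -/
theorem valuesFit_right_of_tracks {y : List (ℕ × ℤ)} (hy : y.Pairwise fun e e' => e.1 ≤ e'.1)
    {c : ℤ} (h : Tracks c y) {s : ℕ} (hs : ∃ e ∈ y, e.1 = s) :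
    ∃ v, ValuesFit s v (c + sumBelow (s + 1) y) := by
  induction y generalizing c with
  | nil => simp at hs
  | cons e y ih =>
    rw [List.pairwise_cons] at hy
    by_cases hs' : ∃ e ∈ y, e.1 = s
    · obtain ⟨v, hv⟩ := ih hy.2 h.2 hs'
      obtain ⟨e', he', rfl⟩ := hs'
      refine ⟨v, ?_⟩
      rwa [sumBelow_cons, if_pos (Nat.lt_succ_of_le (hy.1 e' he')), ← add_assoc]
    · have he : e.1 = s := by
        obtain ⟨e', he', hes⟩ := hs
        rcases List.mem_cons.1 he' with rfl | he'
        · exact hes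
        · exact (hs' ⟨e', he', hes⟩).elim
      subst he
      refine ⟨c, ?_⟩
      rw [sumBelow_cons, if_pos (Nat.lt_succ_self _), sumBelow_eq_zero, add_zero]
      · exact h.1
      · intro e' he'
        exact lt_of_le_of_ne (hy.1 e' he') fun h => hs' ⟨e', he', h.symm⟩

/-- Every clause of `ValuesFit` restricts `v` and `v'` separately, so what the first and the last
move of a segment give can be combined. -/
theorem tracks_iff {y : List (ℕ × ℤ)} (hy : y.Pairwise fun e e' => e.1 ≤ e'.1)
    (hd : ∀ e ∈ y, UpdateFits e.1 e.2) :
    Tracks 0 y ↔ ∀ e ∈ y, ValuesFit e.1 (sumBelow e.1 y) (sumBelow (e.1 + 1) y) := by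
  refine ⟨fun h e he => ?_, tracks_of_valuesFit hy hd⟩
  obtain ⟨_, h₁⟩ := valuesFit_left_of_tracks hy h ⟨e, he, rfl⟩
  obtain ⟨_, h₂⟩ := valuesFit_right_of_tracks hy h ⟨e, he, rfl⟩
  rw [zero_add] at h₁ h₂
  exact ⟨h₁.1, fun h => ⟨(h₁.2.1 h).1, (h₂.2.1 h).2⟩, h₁.2.2.1, h₂.2.2.2.1,
    fun h => ⟨(h₁.2.2.2.2 h).1, (h₂.2.2.2.2 h).2⟩⟩

/-- The least segment, in round `b` of five segments, that is open to a counter with value `c` and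
direction `r`. -/
def firstSegment (b : ℕ) (c : ℤ) (r : SignType) : ℕ :=
  if r = 1 then (if c = 0 then 5 * b else 5 * b + 2) else if c = 0 then 5 * b + 5 else 5 * b + 3

/-- The choice of the segment of a move, within the number of reversals that are left. -/
theorem exists_segment (b : ℕ) {c : ℤ} (r d : SignType) (ds : List SignType) (hr : r ≠ 0)
    (hc : 0 ≤ c) (hcd : 0 ≤ c + d) :
    ∃ (s b' : ℕ) (r' : SignType), r' ≠ 0 ∧ firstSegment b c r ≤ s ∧
      s < 5 * (b + reversals r (d :: ds) + 2) ∧ s ≤ firstSegment b' (c + d) r' ∧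
      UpdateFits s d ∧ ValuesFit s c (c + d) ∧
      b' + reversals r' ds ≤ b + reversals r (d :: ds) := by
  have hr' : r = 1 ∨ r = -1 := by cases r <;> simp_all
  have hd : d = 0 ∨ d = 1 ∨ d = -1 := by cases d <;> simp
  have h₁ : (-1 : SignType) ≠ 1 := by decide
  have h₂ : (1 : SignType) ≠ -1 := by decide
  have h₃ : c + 1 ≠ 0 := by omega
  unfold firstSegment UpdateFits ValuesFit
  rcases hr' with rfl | rfl <;> rcases hd with rfl | rfl | rfl
  · refine ⟨if c = 0 then 5 * b else 5 * b + 2, b, 1, hr, ?_⟩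
    simp [reversals]
    split_ifs <;> omega
  · refine ⟨if c = 0 then 5 * b + 1 else 5 * b + 2, b, 1, hr, ?_⟩
    simp [reversals, h₃]
    split_ifs <;> omega
  · refine ⟨if c = 1 then 5 * b + 4 else 5 * b + 3, b, -1, by decide, ?_⟩
    simp [reversals, h₁] at hcd ⊢
    split_ifs <;> omega
  · refine ⟨if c = 0 then 5 * b + 5 else 5 * b + 3, b, -1, hr, ?_⟩
    simp [reversals, h₁]
    split_ifs <;> omega
  · refine ⟨if c = 0 then 5 * b + 6 else 5 * b + 7, b + 1, 1, by decide, ?_⟩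
    simp [reversals, h₂, h₃]
    split_ifs <;> omega
  · refine ⟨if c = 1 then 5 * b + 4 else 5 * b + 3, b, -1, hr, ?_⟩
    simp [reversals, h₁] at hcd ⊢
    split_ifs <;> omega

end Segments

variable {α : Type} {k : ℕ}

/-- A candidate move of a machine, together with the segment that it belongs to for each of the
counters. -/
structure Move (M : CounterMachine α k) (N : ℕ) where
  src : M.State
  input : Option α
  zero : Fin k → Bool
  dst : M.State
  update : Fin k → SignType
  segment : Fin k → Fin N

/-! ### Words of moves tagged with segments -/

namespace Move

variable {M : CounterMachine α k} {N : ℕ}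

instance [Finite α] : Finite (Move M N) := by
  have := M.finite_state
  refine Finite.of_injective (β := M.State × Option α × (Fin k → Bool) × M.State ×
    (Fin k → SignType) × (Fin k → Fin N))
    (fun m => (m.src, m.input, m.zero, m.dst, m.update, m.segment)) ?_
  rintro ⟨⟩ ⟨⟩ h
  simpa using h

/-- The input read by a sequence of moves. -/
def word (x : List (Move M N)) : List α :=
  x.flatMap fun m => m.input.toList

/-- The behaviour of counter `i`. -/
def track (i : Fin k) (x : List (Move M N)) : List (ℕ × ℤ) :=
  x.map fun m => ((m.segment i : ℕ), ((m.update i : SignType) : ℤ))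

/-- `m` is a move from state `p.1` in segments not before `p.2`, all of whose local conditions are
met. -/
def IsLegal (p : M.State × (Fin k → Fin N)) (m : Move M N) : Prop :=
  m.src = p.1 ∧ M.trans m.src m.input m.zero m.dst m.update ∧
    ∀ i, p.2 i ≤ m.segment i ∧ UpdateFits (m.segment i) (m.update i : SignType) ∧
      m.zero i = decide ((m.segment i : ℕ) % 5 ≤ 1)

open scoped Classical in
/-- The control of a machine, without the counter values. -/
noncomputable def step (p : M.State × (Fin k → Fin N)) (m : Move M N) :
    Option (M.State × (Fin k → Fin N)) :=
  if IsLegal p m then some (m.dst, m.segment) else none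

/-- `x` is a sequence of legal moves from `p` to an accepting state. -/
def Accepts (p : M.State × (Fin k → Fin N)) (x : List (Move M N)) : Prop :=
  LanguageFamily.partialAccepts step {p | p.1 ∈ M.accept} p x

theorem accepts_cons {p : M.State × (Fin k → Fin N)} {m : Move M N} {x : List (Move M N)} :
    Accepts p (m :: x) ↔ IsLegal p m ∧ Accepts (m.dst, m.segment) x := by
  unfold Accepts
  rw [LanguageFamily.partialAccepts]
  by_cases h : IsLegal p m <;> simp [step, h]

theorem isRegular_accepts (p : M.State × (Fin k → Fin N)) :
    Language.IsRegular ({x | Accepts p x} : Language (Move M N)) :=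
  have := M.finite_state
  LanguageFamily.isRegular_partialAccepts _ _ _ Set.finite_univ trivial fun _ _ _ _ _ => trivial

theorem Accepts.track_le {p : M.State × (Fin k → Fin N)} {x : List (Move M N)} (h : Accepts p x)
    (i : Fin k) : ((track i x).Pairwise fun e e' => e.1 ≤ e'.1) ∧
      ∀ e ∈ track i x, (p.2 i : ℕ) ≤ e.1 ∧ UpdateFits e.1 e.2 := by
  induction x generalizing p with
  | nil => simp [track]
  | cons m x ih =>
    rw [accepts_cons] at h
    obtain ⟨ih₁, ih₂⟩ := ih h.2
    obtain ⟨h₁, h₂, -⟩ := h.1.2.2 i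
    refine ⟨List.pairwise_cons.2 ⟨fun e he => (ih₂ e he).1, ih₁⟩, fun e he => ?_⟩
    rcases List.mem_cons.1 he with rfl | he
    · exact ⟨h₁, h₂⟩
    · exact ⟨le_trans (show (p.2 i : ℕ) ≤ m.segment i from h₁) (ih₂ e he).1, (ih₂ e he).2⟩

theorem Accepts.tracks_iff {p : M.State × (Fin k → Fin N)} {x : List (Move M N)}
    (h : Accepts p x) (i : Fin k) : Tracks 0 (track i x) ↔
      ∀ e ∈ track i x, ValuesFit e.1 (sumBelow e.1 (track i x)) (sumBelow (e.1 + 1) (track i x)) :=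
  CounterMachine.tracks_iff (h.track_le i).1 fun e he => ((h.track_le i).2 e he).2

/-- Legal moves that fit their segments form a computation. -/
theorem Accepts.exists_run {p : M.State × (Fin k → Fin N)} {x : List (Move M N)}
    (h : Accepts p x) {c : Fin k → ℕ} (hc : ∀ i, Tracks (c i) (track i x)) :
    ∃ ds q c', q ∈ M.accept ∧ M.Run ⟨p.1, word x, c⟩ ds ⟨q, [], c'⟩ := by
  induction x generalizing p c with
  | nil => exact ⟨[], p.1, c, h, .nil _⟩
  | cons m x ih =>
    rw [accepts_cons] at h
    obtain ⟨⟨hsrc, htrans, hm⟩, hx⟩ := h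
    -- Exactly the kinds 0 and 1 start their moves at value zero, so the zero test recorded in a
    -- legal move agrees with the actual counter. No move that fits makes the counter negative.
    have hv (i) : ((c i : ℤ) = 0 ↔ (m.segment i : ℕ) % 5 ≤ 1) ∧
        0 ≤ (c i : ℤ) + ((m.update i : SignType) : ℤ) := by
      have h₁ := (hm i).2.1
      have h₂ := (hc i).1
      unfold UpdateFits at h₁
      unfold ValuesFit at h₂
      dsimp only at h₂
      omega
    choose c' hc' using fun i => Int.eq_ofNat_of_zero_le (hv i).2
    obtain ⟨ds, q, c'', hq, hrun⟩ := ih hx (c := c') fun i => by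
      have := (hc i).2
      dsimp only at this
      rwa [hc' i] at this
    refine ⟨m.update :: ds, q, c'', hq, .cons (y := ⟨m.dst, word x, c'⟩) ?_ hrun⟩
    rw [← hsrc]
    refine .mk (a := m.input) ?_ fun i => (hc' i).symm
    have hz : (fun i => decide (c i = 0)) = m.zero := by
      funext i
      rw [(hm i).2.2]
      exact decide_eq_decide.2 (by simpa using (hv i).1)
    rwa [hz]

end Move

/-- A computation with few reversals comes from legal moves that fit their segments. -/
theorem Run.exists_moves {M : CounterMachine α k} {N : ℕ} {x y : M.Config}
    {ds : List (Fin k → SignType)} (h : M.Run x ds y) (hy : y.state ∈ M.accept)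
    (hrest : y.rest = []) (b : Fin k → ℕ) (r : Fin k → SignType) (hr : ∀ i, r i ≠ 0)
    (t : Fin k → Fin N) (ht : ∀ i, (t i : ℕ) ≤ firstSegment (b i) (x.counters i) (r i))
    (hN : ∀ i, 5 * (b i + reversals (r i) (ds.map fun d => d i) + 2) ≤ N) :
    ∃ z : List (Move M N), Move.word z = x.rest ∧ Move.Accepts (x.state, t) z ∧
      ∀ i, Tracks (x.counters i) (Move.track i z) := by
  induction h generalizing b r t with
  | nil x => exact ⟨[], hrest.symm, hy, fun _ => trivial⟩
  | @cons x y z d ds hstep hrun ih =>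
    cases hstep with
    | @mk q p a w c c' _ htrans hcounters =>
      choose s b' r' hr' h₁ h₂ h₃ h₄ h₅ h₆ using fun i =>
        exists_segment (b i) (c := c i) (r i) (d i) (ds.map fun d => d i) (hr i) (by simp)
          (hcounters i ▸ by simp)
      have hs (i) : s i < N := lt_of_lt_of_le (h₂ i) (hN i)
      obtain ⟨z, hz, hacc, htr⟩ := ih hy hrest b' r' hr' (fun i => ⟨s i, hs i⟩)
        (fun i => by have := h₃ i; rwa [← hcounters i] at this)
        (fun i => by have := h₆ i; have := hN i; rw [List.map_cons] at this; omega)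
      refine ⟨⟨q, a, fun i => decide (c i = 0), p, d, fun i => ⟨s i, hs i⟩⟩ :: z, ?_, ?_, ?_⟩
      · change a.toList ++ Move.word z = _
        rw [hz]
      · refine Move.accepts_cons.2 ⟨⟨rfl, htrans, fun i => ⟨(ht i).trans (h₁ i), h₄ i, ?_⟩⟩, hacc⟩
        refine decide_eq_decide.2 ?_
        have h₄ := h₄ i
        have h₅ := h₅ i
        unfold UpdateFits at h₄
        unfold ValuesFit at h₅
        dsimp only
        omega
      · intro i
        refine ⟨h₅ i, ?_⟩
        have := htr i
        rwa [hcounters i] at this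

end CounterMachine

/-! ### Intersection with reversal-bounded counter languages -/

namespace LanguageFamily

open CounterMachine

theorem isSemilinearSet_Ici_one : IsSemilinearSet (Set.Ici (1 : ℤ)) := by
  refine IsLinearSet.isSemilinearSet ⟨1, {1}, Set.finite_singleton 1, ?_⟩
  ext z
  rw [Set.mem_vadd_set]
  constructor
  · intro hz
    refine ⟨z - 1, AddSubmonoid.mem_closure_singleton.2 ⟨(z - 1).toNat, ?_⟩, by simp⟩
    have : 1 ≤ z := hz
    rw [nsmul_one]
    omega
  · rintro ⟨y, hy, rfl⟩
    obtain ⟨n, rfl⟩ := AddSubmonoid.mem_closure_singleton.1 hy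
    simp

theorem isSemilinearSet_valuesFit (s : ℕ) :
    IsSemilinearSet {v : ℤ × ℤ | ValuesFit s v.1 v.2} := by
  have h₀ (z : ℤ) : IsSemilinearSet {v : ℤ × ℤ | v.1 = z} :=
    (IsSemilinearSet.singleton z).preimage (AddMonoidHom.fst ℤ ℤ)
  have h₁ (z : ℤ) : IsSemilinearSet {v : ℤ × ℤ | v.2 = z} :=
    (IsSemilinearSet.singleton z).preimage (AddMonoidHom.snd ℤ ℤ)
  have h₂ : IsSemilinearSet {v : ℤ × ℤ | 1 ≤ v.1} :=
    isSemilinearSet_Ici_one.preimage (AddMonoidHom.fst ℤ ℤ)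
  have h₃ : IsSemilinearSet {v : ℤ × ℤ | 1 ≤ v.2} :=
    isSemilinearSet_Ici_one.preimage (AddMonoidHom.snd ℤ ℤ)
  have hs : s % 5 = 0 ∨ s % 5 = 1 ∨ s % 5 = 2 ∨ s % 5 = 3 ∨ s % 5 = 4 := by omega
  unfold ValuesFit
  rcases hs with h | h | h | h | h <;> simp only [h] <;> norm_num
  · exact h₀ 0
  · exact (h₀ 0).inter (h₁ 1)
  · exact h₂
  · exact h₃
  · exact (h₀ 1).inter (h₁ 0)

/-- Both the number of moves in segment `s` and the two boundary values are linear in the Parikh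
vector: either the first vanishes, or the boundary values lie in a semilinear subset of ℤ × ℤ. -/
theorem isSemilinearSet_segmentFits {α : Type} [Finite α] {k N : ℕ} (M : CounterMachine α k)
    (i : Fin k) (s : ℕ) : ∃ T : Set (Move M N → ℕ), IsSemilinearSet T ∧
      ∀ x : List (Move M N), parikh x ∈ T ↔ ((∃ e ∈ Move.track i x, e.1 = s) →
        ValuesFit s (sumBelow s (Move.track i x)) (sumBelow (s + 1) (Move.track i x))) := by
  let f : Move M N → ℕ := fun m => if (m.segment i : ℕ) = s then 1 else 0
  let g : ℕ → Move M N → ℤ := fun s m =>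
    if (m.segment i : ℕ) < s then ((m.update i : SignType) : ℤ) else 0
  have hf (x : List (Move M N)) : weight f (parikh x) = 0 ↔ ¬ ∃ e ∈ Move.track i x, e.1 = s := by
    rw [weight_parikh, List.sum_eq_zero_iff]
    simp [f, Move.track]
  have hg (s : ℕ) (x : List (Move M N)) :
      weight (g s) (parikh x) = sumBelow s (Move.track i x) := by
    rw [weight_parikh, sumBelow, Move.track, List.map_map]
    rfl
  refine ⟨weight f ⁻¹' {0} ∪ ((weight (g s)).prod (weight (g (s + 1)))) ⁻¹'
    {v | ValuesFit s v.1 v.2}, ((IsSemilinearSet.singleton 0).preimage _).union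
      ((isSemilinearSet_valuesFit s).preimage _), fun x => ?_⟩
  rw [← hg, ← hg, imp_iff_not_or, ← hf]
  rfl

/-- The intersection is the image, under reading off the input, of the legal words of moves whose
input lies in `L` and whose Parikh vector meets all segment constraints. -/
theorem hereditary_closedUnderInter_NCM : hereditary.ClosedUnderInter NCM := by
  rintro α _ L hL _ ⟨k, l, M, hM, rfl⟩
  -- This is the bound of `exists_segment` for a computation that starts in round 0 with at most `l`
  -- reversals.
  let N := 5 * (l + 2)
  let p : M.State × (Fin k → Fin N) := (M.start, fun _ => ⟨0, by omega⟩)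
  choose T hT hTx using fun (i : Fin k) (s : Fin N) =>
    isSemilinearSet_segmentFits (N := N) M i s
  have key := hereditary.homImage (hereditary.inf_parikh (hereditary.inf_isRegular
    (hereditary.homPreimage hL fun m : Move M N => m.input.toList) (Move.isRegular_accepts p))
    (IsSemilinearSet.iInter fun i => IsSemilinearSet.iInter fun s => hT i s))
    fun m : Move M N => m.input.toList
  convert key using 1
  ext w
  have hcount {x : List (Move M N)} (hx : Move.Accepts p x) :
      parikh x ∈ (⋂ i, ⋂ s, T i s) ↔ ∀ i, Tracks 0 (Move.track i x) := by
    simp only [Set.mem_iInter, hTx]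
    refine forall_congr' fun i => ?_
    rw [hx.tracks_iff i]
    constructor
    · rintro h e he
      obtain ⟨m, -, rfl⟩ := List.mem_map.1 he
      exact h (m.segment i) ⟨_, he, rfl⟩
    · rintro h s ⟨e, he, hes⟩
      rw [← hes]
      exact h e he
  constructor
  · rintro ⟨hwL, ds, hds⟩
    have hl := hM w ds hds
    obtain ⟨q, c, hq, hrun⟩ := hds
    obtain ⟨x, hxw, hx, htr⟩ := hrun.exists_moves hq rfl (fun _ => 0) (fun _ => 1)
      (fun _ => by decide) p.2 (fun _ => Nat.zero_le _)
      (fun i => by have := hl i; dsimp only [N]; omega)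
    exact ⟨x, ⟨⟨show Move.word x ∈ L from hxw ▸ hwL, hx⟩, (hcount hx).2 htr⟩, hxw⟩
  -- The reversal bound plays no role in this direction: any feasible word of moves is an accepting
  -- computation.
  · rintro ⟨x, ⟨⟨hxL, hx⟩, hxT⟩, rfl⟩
    obtain ⟨ds, q, c, hq, hrun⟩ := hx.exists_run (c := fun _ => 0) ((hcount hx).1 hxT)
    exact ⟨hxL, ds, q, c, hq, hrun⟩

end LanguageFamily

theorem proposition3 (F : LanguageFamily) (hF : F.IsFullTrio) (hsemi : F.IsSemilinear) :
    (LanguageFamily.fullAFLNCM F).IsSemilinear := by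
  intro α _ L hL
  exact LanguageFamily.isSemilinear_hereditary α L
    (hL _ LanguageFamily.isFullAFL_hereditary LanguageFamily.hereditary_closedUnderInter_NCM
      (LanguageFamily.contained_hereditary hF hsemi))
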